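/- A regular network consists of a finite nonempty set of cells $\{1,\dots,n\}$ and finitely many arrows between cells (loops and multiple arrows allowed, all cells of the same type, all arrows of the same type) such that every cell receives the same number $v$ of arrows (the valency). Its adjacency matrix is $A=[a_{ij}]$, where $a_{ij}$ is the number of arrows that cell $i$ receives from cell $j$. Each cell has phase space $\mathbb C$, so the total phase space is $\mathbb C^n$. An admissible vector field is a map $f:\mathbb C^n\to\mathbb C^n$ with $f_c(x)=g(x_c;x_{d_1},\dots,x_{d_v})$ for every cell $c$, where $d_1,\dots,d_v$ are the sources (with multiplicity) of the arrows received by $c$, and $g:\mathbb C\times\mathbb C^v\to\mathbb C$ is one function, the same for all cells, that is real-smooth and invariant under permutations of its last $v$ arguments. A polydiagonal is a subspace of $\mathbb C^n$ defined by equalities of certain coordinates; for a subspace $W$, $P(W)$ is the smallest polydiagonal containing $W$; $F=\{x_1=\dots=x_n\}$. A synchrony subspace is a polydiagonal that is flow invariant for every admissible vector field. Ordered by inclusion, the synchrony subspaces form a complete lattice, whose meet is intersection. An element of a lattice is join-irreducible if it is not the join of two elements different from it (so the least element is join-irreducible). A Jordan subspace is a subspace spanned by a Jordan chain of $A$, that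 is, by nonzero vectors $x_1,\dots,x_k$ ($k\ge 1$) with $(A-\lambda I)x_1=0$ and $(A-\lambda I)x_{i}=x_{i-1}$ for $2\le i\le k$, for some $\lambda\in\mathbb C$. A Jordan subspace $W$ contained in a generalized eigenspace $G$ of $A$ is a special Jordan subspace (to the network) if every Jordan subspace $U\subseteq G$ with $\dim U=\dim W$ and $P(U)\subseteq P(W)$ satisfies $P(U)=P(W)$ or $U=F$. Proposition 5.1 (join-irreducible elements). In the lattice of synchrony subspaces of a regular network, every join-irreducible element is the smallest synchrony subspace containing some special Jordan subspace. Moreover, the number of join-irreducible elements of this lattice is at most the number of special Jordan subspaces (which may be infinite). -/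

import Mathlib

open Set Cardinal
open scoped ContDiff

/-- A regular network with set of cells `C` and set of arrows `E`: a directed multigraph (loops and
multiple arrows are allowed, all cells have the same type, all arrows have the same type) in which
every cell receives exactly `valency` arrows. -/
structure RegularNetwork (C E : Type*) where
  /-- the cell from which an arrow starts -/
  source : E → C
  /-- the cell that receives an arrow -/
  target : E → C
  /-- the number of arrows that input to each cell -/
  valency : ℕ
  inputs_equiv : ∀ c : C, Nonempty (Fin valency ≃ {a : E // target a = c})

section Polydiagonals

variable {C : Type*}

/-- A polydiagonal of `ℂ^C` is a subspace defined by the equalities of certain coordinates. -/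
def IsPolydiagonal (D : Submodule ℂ (C → ℂ)) : Prop :=
  ∃ r : C → C → Prop, ∀ x : C → ℂ, x ∈ D ↔ ∀ i j, r i j → x i = x j

theorem isPolydiagonal_sInf {s : Set (Submodule ℂ (C → ℂ))} (hs : ∀ D ∈ s, IsPolydiagonal D) :
    IsPolydiagonal (sInf s) := by
  refine ⟨fun i j => ∃ D ∈ s, ∀ x ∈ D, x i = x j, fun x => ⟨?_, ?_⟩⟩
  · rintro hx i j ⟨D, hD, h⟩
    exact h x ((Submodule.mem_sInf.1 hx) D hD)
  · intro h
    refine Submodule.mem_sInf.2 fun D hD => ?_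
    obtain ⟨r, hr⟩ := hs D hD
    exact (hr x).2 fun i j hij => h i j ⟨D, hD, fun y hy => (hr y).1 hy i j hij⟩

/-- `P(W)`: the smallest polydiagonal containing `W`. -/
noncomputable def polydiagonalHull (W : Submodule ℂ (C → ℂ)) : Submodule ℂ (C → ℂ) :=
  sInf {D | IsPolydiagonal D ∧ W ≤ D}

theorem isLeast_polydiagonalHull (W : Submodule ℂ (C → ℂ)) :
    IsLeast {D | IsPolydiagonal D ∧ W ≤ D} (polydiagonalHull W) :=
  ⟨⟨isPolydiagonal_sInf fun _ h => h.1, le_sInf fun _ h => h.2⟩, fun _ h => sInf_le h⟩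

/-- `F`: the fully synchrony subspace, defined by the equalities of all coordinates. -/
def fullySynchrony (C : Type*) : Submodule ℂ (C → ℂ) where
  carrier := {x | ∀ i j, x i = x j}
  add_mem' := fun {a b} ha hb i j => by simp [ha i j, hb i j]
  zero_mem' := fun _ _ => rfl
  smul_mem' := fun c x hx i j => by simp [hx i j]

end Polydiagonals

/-- A set `Δ` of states is flow invariant for the vector field `f` when every solution of
`x' = f(x)`, on a compact time interval around time `0`, that is in `Δ` at time `0` stays in `Δ`. -/
def IsFlowInvariant {X : Type*} [NormedAddCommGroup X] [NormedSpace ℝ X]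
    (f : X → X) (Δ : Set X) : Prop :=
  ∀ (a b : ℝ) (x : ℝ → X), a ≤ 0 → 0 ≤ b → IsIntegralCurveOn x (fun _ => f) (Icc a b) →
    x 0 ∈ Δ → ∀ t ∈ Icc a b, x t ∈ Δ

section JordanSubspaces

variable {X : Type*} [AddCommGroup X] [Module ℂ X]

/-- `x 0, …, x (k - 1)` is a Jordan chain of length `k` of `A` associated with `μ`. -/
structure IsJordanChain (A : Module.End ℂ X) (μ : ℂ) {k : ℕ} (x : Fin k → X) : Prop where
  ne_zero : ∀ i, x i ≠ 0
  map_first : ∀ i : Fin k, (i : ℕ) = 0 → A (x i) - μ • x i = 0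
  map_next : ∀ i j : Fin k, (j : ℕ) = (i : ℕ) + 1 → A (x j) - μ • x j = x i

/-- A Jordan subspace of `A` is a subspace spanned by a (nonempty) Jordan chain. -/
def IsJordanSubspace (A : Module.End ℂ X) (W : Submodule ℂ X) : Prop :=
  ∃ (μ : ℂ) (k : ℕ) (x : Fin k → X), 1 ≤ k ∧ IsJordanChain A μ x ∧ W = Submodule.span ℂ (range x)

end JordanSubspaces

namespace RegularNetwork

section Definitions

variable {C E : Type*} [Fintype C] (N : RegularNetwork C E)

/-- The adjacency matrix: the entry `(i, j)` is the number of arrows that cell `i` receives from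
cell `j`. -/
noncomputable def adjacencyMatrix : Matrix C C ℂ :=
  Matrix.of fun i j => (Nat.card {a : E // N.target a = i ∧ N.source a = j} : ℂ)

/-- The linear map of `ℂ^C` given by the adjacency matrix. -/
noncomputable def adjacencyMap : Module.End ℂ (C → ℂ) :=
  N.adjacencyMatrix.mulVecLin

/-- The admissible vector fields on the total phase space `ℂ^C` (each cell has phase space
`ℂ = ℝ²`): all cells have the same differential equation `x_c' = g(x_c; x_{d₁}, …, x_{d_v})`, where
`d₁, …, d_v` are the sources, counted with multiplicity, of the arrows that cell `c` receives, and
`g` is smooth over `ℝ` and, as all arrows have the same type, invariant under all permutations of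
its last `v` arguments. -/
def IsAdmissible (f : (C → ℂ) → (C → ℂ)) : Prop :=
  ∃ g : ℂ × (Fin N.valency → ℂ) → ℂ, ContDiff ℝ ∞ g ∧
    (∀ (u : ℂ) (y : Fin N.valency → ℂ) (σ : Equiv.Perm (Fin N.valency)),
      g (u, y ∘ σ) = g (u, y)) ∧
    ∀ (x : C → ℂ) (c : C) (e : Fin N.valency ≃ {a : E // N.target a = c}),
      f x c = g (x c, fun i => x (N.source (e i).1))

/-- A synchrony subspace is a polydiagonal that is flow invariant for every admissible vector
field. -/
def IsSynchrony (S : Submodule ℂ (C → ℂ)) : Prop :=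
  IsPolydiagonal S ∧ ∀ f, N.IsAdmissible f → IsFlowInvariant f (S : Set (C → ℂ))

theorem isSynchrony_sInf {s : Set (Submodule ℂ (C → ℂ))} (hs : ∀ S ∈ s, N.IsSynchrony S) :
    N.IsSynchrony (sInf s) := by
  refine ⟨isPolydiagonal_sInf fun D hD => (hs D hD).1, fun f hf a b x ha hb hx h0 t ht => ?_⟩
  exact Submodule.mem_sInf.2 fun S hS =>
    (hs S hS).2 f hf a b x ha hb hx (Submodule.mem_sInf.1 h0 S hS) t ht

/-- The synchrony subspaces of `N`, ordered by inclusion. -/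
abbrev SynchronySubspace : Type _ :=
  {S : Submodule ℂ (C → ℂ) // N.IsSynchrony S}

/-- The synchrony subspaces form a complete lattice under inclusion, with intersection as meet. -/
noncomputable instance : CompleteLattice N.SynchronySubspace :=
  letI : InfSet N.SynchronySubspace :=
    ⟨fun s => ⟨sInf (Subtype.val '' s), N.isSynchrony_sInf (by
      rintro _ ⟨S, _, rfl⟩
      exact S.2)⟩⟩
  completeLatticeOfInf N.SynchronySubspace fun _ =>
    ⟨fun S hS => show sInf _ ≤ S.1 from sInf_le ⟨S, hS, rfl⟩,
      fun T hT => show T.1 ≤ sInf _ from le_sInf (by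
        rintro _ ⟨S, hS, rfl⟩
        exact hT hS)⟩

/-- A special Jordan subspace to the network: a Jordan subspace `W` of a generalized eigenspace `G`
of the adjacency matrix such that every Jordan subspace `U` of `G` with `dim U = dim W` and
`P(U) ⊆ P(W)` satisfies `P(U) = P(W)` or `U = F`. -/
def IsSpecialJordan (W : Submodule ℂ (C → ℂ)) : Prop :=
  IsJordanSubspace N.adjacencyMap W ∧
    ∃ μ : ℂ, W ≤ N.adjacencyMap.maxGenEigenspace μ ∧
      ∀ U : Submodule ℂ (C → ℂ), IsJordanSubspace N.adjacencyMap U →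
        U ≤ N.adjacencyMap.maxGenEigenspace μ →
        Module.finrank ℂ U = Module.finrank ℂ W →
        polydiagonalHull U ≤ polydiagonalHull W →
        polydiagonalHull U = polydiagonalHull W ∨ U = fullySynchrony C

end Definitions

end RegularNetwork

/-- An element of a lattice is join-irreducible when it is not the join of two other elements. In
contrast to `SupIrred`, the least element of the lattice is join-irreducible. -/
def IsJoinIrreducible {L : Type*} [Lattice L] (s : L) : Prop :=
  ¬ ∃ a b : L, a ≠ s ∧ b ≠ s ∧ a ⊔ b = s

/-! Flow invariance enters through the linear admissible field `A`: every synchrony subspace is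
`A`-invariant. For a join-irreducible `S`, the synchrony subspaces strictly below `S` have a
greatest member `V` (take `V = 0` if there are none), so a Jordan subspace of `S` not inside `V`
lies in no smaller synchrony subspace. Pick a generalized eigenvector `y` in `S \ V` with nilpotency
exponent minimal, then with `P(W)` minimal for the Jordan subspace `W` generated by `y`. If `W` were
not special, some `U ≠ F` of equal dimension would have `P(U) < P(W)`; minimality puts `U` inside
`V`. The eigenvector of `U` is not fully synchronous, as a constant eigenvector begins no longer
chain (maximum principle), so it separates two cells `a`, `b`. Correcting `y` by some `w ∈ U` makes
`x a = x b` on the whole new chain (`exists_mem_cyclicSpan_forall_apply_eq_zero`). Still `y + w ∈ S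
\ V`, and its hull is strictly smaller: contradiction. -/

/-! ### Cyclic subspaces and Jordan chains -/

section CyclicSpan

variable {X : Type*} [AddCommGroup X] [Module ℂ X]

/-- The span of the orbit of `y` under `f`. -/
def cyclicSpan (f : Module.End ℂ X) (y : X) : Submodule ℂ X :=
  Submodule.span ℂ (range fun i : ℕ => (f ^ i) y)

theorem pow_mem_cyclicSpan (f : Module.End ℂ X) (y : X) (i : ℕ) : (f ^ i) y ∈ cyclicSpan f y :=
  Submodule.subset_span ⟨i, rfl⟩

theorem self_mem_cyclicSpan (f : Module.End ℂ X) (y : X) : y ∈ cyclicSpan f y :=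
  pow_mem_cyclicSpan f y 0

theorem pow_mem_of_invariant {f : Module.End ℂ X} {V : Submodule ℂ X} (hV : ∀ x ∈ V, f x ∈ V)
    {y : X} (hy : y ∈ V) (i : ℕ) : (f ^ i) y ∈ V := by
  induction i with
  | zero => exact hy
  | succ i ih =>
    rw [pow_succ', Module.End.mul_apply]
    exact hV _ ih

theorem cyclicSpan_le_of_invariant {f : Module.End ℂ X} {V : Submodule ℂ X}
    (hV : ∀ x ∈ V, f x ∈ V) {y : X} (hy : y ∈ V) : cyclicSpan f y ≤ V := by
  refine Submodule.span_le.2 ?_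
  rintro _ ⟨i, rfl⟩
  exact pow_mem_of_invariant hV hy i

theorem map_mem_cyclicSpan {f : Module.End ℂ X} {y x : X} (hx : x ∈ cyclicSpan f y) :
    f x ∈ cyclicSpan f y := by
  suffices h : cyclicSpan f y ≤ (cyclicSpan f y).comap f from h hx
  refine Submodule.span_le.2 ?_
  rintro _ ⟨i, rfl⟩
  have := pow_mem_cyclicSpan f y (i + 1)
  rwa [pow_succ', Module.End.mul_apply] at this

theorem pow_apply_eq_zero_of_le {f : Module.End ℂ X} {y : X} {k i : ℕ} (hk : (f ^ k) y = 0)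
    (hi : k ≤ i) : (f ^ i) y = 0 := by
  obtain ⟨m, rfl⟩ := Nat.exists_eq_add_of_le' hi
  rw [pow_add, Module.End.mul_apply, hk, map_zero]

theorem cyclicSpan_eq_span_fin {f : Module.End ℂ X} {y : X} {k : ℕ} (hk : (f ^ k) y = 0) :
    cyclicSpan f y = Submodule.span ℂ (range fun i : Fin k => (f ^ (i : ℕ)) y) := by
  refine le_antisymm (Submodule.span_le.2 ?_) (Submodule.span_mono ?_)
  · rintro _ ⟨i, rfl⟩
    rcases lt_or_ge i k with hi | hi
    · exact Submodule.subset_span ⟨⟨i, hi⟩, rfl⟩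
    · rw [SetLike.mem_coe]
      dsimp only
      rw [pow_apply_eq_zero_of_le hk hi]
      exact zero_mem _
  · rintro _ ⟨i, rfl⟩
    exact ⟨i, rfl⟩

/-- Induction through the shorter chain of `f y`: the power `f ^ (k + 1)` kills that chain but not
`y`. -/
theorem linearIndependent_pow_apply (f : Module.End ℂ X) {k : ℕ} :
    ∀ {y : X}, (f ^ (k + 1)) y = 0 → (f ^ k) y ≠ 0 →
      LinearIndependent ℂ fun i : Fin (k + 1) => (f ^ (i : ℕ)) y := by
  induction k with
  | zero =>
    intro y _ h
    have : Subsingleton (Fin (0 + 1)) := inferInstanceAs (Subsingleton (Fin 1))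
    exact LinearIndependent.of_subsingleton (0 : Fin 1) (by simpa using h)
  | succ k ih =>
    intro y h0 h
    rw [linearIndependent_finSucc]
    have e : (Fin.tail fun i : Fin (k + 1 + 1) => (f ^ (i : ℕ)) y) =
        fun i : Fin (k + 1) => (f ^ (i : ℕ)) (f y) := by
      funext i
      simp [Fin.tail, pow_succ]
    rw [e]
    refine ⟨ih (by rwa [← Module.End.mul_apply, ← pow_succ])
      (by rwa [← Module.End.mul_apply, ← pow_succ]), fun hy => h ?_⟩
    suffices hle : Submodule.span ℂ (range fun i : Fin (k + 1) => (f ^ (i : ℕ)) (f y)) ≤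
        LinearMap.ker (f ^ (k + 1)) from hle hy
    refine Submodule.span_le.2 ?_
    rintro _ ⟨i, rfl⟩
    rw [SetLike.mem_coe, LinearMap.mem_ker]
    change (f ^ (k + 1)) ((f ^ (i : ℕ)) (f y)) = 0
    rw [← Module.End.mul_apply, ← pow_add, ← Module.End.mul_apply, ← pow_succ]
    exact pow_apply_eq_zero_of_le h0 (by omega)

theorem finrank_cyclicSpan {f : Module.End ℂ X} {y : X} {k : ℕ} (h0 : (f ^ (k + 1)) y = 0)
    (h : (f ^ k) y ≠ 0) : Module.finrank ℂ (cyclicSpan f y) = k + 1 := by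
  rw [cyclicSpan_eq_span_fin h0, finrank_span_eq_card (linearIndependent_pow_apply f h0 h),
    Fintype.card_fin]

theorem isJordanSubspace_cyclicSpan {A : Module.End ℂ X} {μ : ℂ} {y : X} {k : ℕ}
    (h0 : ((A - μ • (1 : Module.End ℂ X)) ^ (k + 1)) y = 0)
    (h : ((A - μ • (1 : Module.End ℂ X)) ^ k) y ≠ 0) :
    IsJordanSubspace A (cyclicSpan (A - μ • (1 : Module.End ℂ X)) y) := by
  set f := A - μ • (1 : Module.End ℂ X) with hf
  have hfA (x : X) : A x - μ • x = f x := by simp [hf]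
  -- Jordan chains start at the eigenvector, orbits end there; hence the reversed index.
  refine ⟨μ, k + 1, fun i => (f ^ (k - i : ℕ)) y, by omega, ⟨fun i hi => h ?_, fun i hi => ?_,
    fun i j hij => ?_⟩, ?_⟩
  · exact pow_apply_eq_zero_of_le hi (by omega)
  · rw [hfA, ← Module.End.mul_apply, ← pow_succ', hi]
    exact h0
  · rw [hfA, ← Module.End.mul_apply, ← pow_succ']
    congr 2
    omega
  · rw [cyclicSpan_eq_span_fin h0]
    congr 1
    ext x
    constructor
    · rintro ⟨i, rfl⟩
      refine ⟨Fin.rev i, ?_⟩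
      dsimp only
      congr 2
      rw [Fin.val_rev]
      omega
    · rintro ⟨i, rfl⟩
      refine ⟨Fin.rev i, ?_⟩
      dsimp only
      congr 2
      rw [Fin.val_rev]
      omega

theorem IsJordanSubspace.exists_eq_cyclicSpan {A : Module.End ℂ X} {W : Submodule ℂ X}
    (hW : IsJordanSubspace A W) : ∃ (μ : ℂ) (k : ℕ) (y : X),
      ((A - μ • (1 : Module.End ℂ X)) ^ (k + 1)) y = 0 ∧
      ((A - μ • (1 : Module.End ℂ X)) ^ k) y ≠ 0 ∧
      W = cyclicSpan (A - μ • (1 : Module.End ℂ X)) y := by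
  obtain ⟨μ, k, x, hk, hx, rfl⟩ := hW
  obtain ⟨k, rfl⟩ := Nat.exists_eq_add_of_le' hk
  set f := A - μ • (1 : Module.End ℂ X) with hf
  have hfA (x : X) : f x = A x - μ • x := by simp [hf]
  have key (i : ℕ) (hi : i ≤ k) : (f ^ i) (x (Fin.last k)) = x ⟨k - i, by omega⟩ := by
    induction i with
    | zero => rfl
    | succ i ih =>
      rw [pow_succ', Module.End.mul_apply, ih (by omega), hfA]
      exact hx.map_next _ _ (by simp; omega)
  have h0 : (f ^ (k + 1)) (x (Fin.last k)) = 0 := by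
    rw [pow_succ', Module.End.mul_apply, key k le_rfl, hfA]
    exact hx.map_first _ (by simp)
  refine ⟨μ, k, x (Fin.last k), h0, by rw [key k le_rfl]; exact hx.ne_zero _, ?_⟩
  rw [cyclicSpan_eq_span_fin h0]
  congr 1
  ext z
  constructor
  · rintro ⟨i, rfl⟩
    refine ⟨Fin.rev i, ?_⟩
    dsimp only
    rw [key _ (by omega)]
    congr 1
    ext
    simp [Fin.val_rev]
    omega
  · rintro ⟨i, rfl⟩
    exact ⟨⟨k - i, by omega⟩, (key _ (by omega)).symm⟩

/-- A linear functional that does not vanish on the eigenvector of a Jordan chain can be made to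
vanish on a second chain of the same length, by adding to it a combination of the first one. -/
theorem exists_mem_cyclicSpan_forall_apply_eq_zero {f : Module.End ℂ X} (L : X →ₗ[ℂ] ℂ) {y u : X}
    {k : ℕ} (hy : (f ^ (k + 1)) y = 0) (hu : (f ^ (k + 1)) u = 0) (hL : L ((f ^ k) u) ≠ 0) :
    ∃ w ∈ cyclicSpan f u, ∀ j, L ((f ^ j) (y + w)) = 0 := by
  -- Work down from the eigenvector: `m` counts the top powers already corrected.
  suffices h : ∀ m ≤ k + 1, ∃ w ∈ cyclicSpan f u, ∀ j, k + 1 ≤ j + m →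
      L ((f ^ j) (y + w)) = 0 by
    obtain ⟨w, hw, h⟩ := h (k + 1) le_rfl
    exact ⟨w, hw, fun j => h j (by omega)⟩
  intro m hm
  induction m with
  | zero =>
    refine ⟨0, zero_mem _, fun j hj => ?_⟩
    rw [add_zero, pow_apply_eq_zero_of_le hy (by omega), map_zero]
  | succ m ih =>
    obtain ⟨w, hw, h⟩ := ih (by omega)
    -- Adding a multiple of `(f ^ m) u` leaves powers above `k - m` unchanged; `c` cancels the value
    -- at `k - m`.
    set c := -(L ((f ^ (k - m)) (y + w)) / L ((f ^ k) u)) with hc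
    refine ⟨w + c • (f ^ m) u, add_mem hw (Submodule.smul_mem _ _ (pow_mem_cyclicSpan _ _ _)),
      fun j hj => ?_⟩
    rw [← add_assoc, map_add, map_smul, ← Module.End.mul_apply (f ^ j) (f ^ m), ← pow_add, map_add,
      map_smul]
    rcases (show k + 1 ≤ j + m ∨ j = k - m by omega) with hj' | rfl
    · rw [h j hj', pow_apply_eq_zero_of_le hu hj', map_zero, smul_zero, add_zero]
    · rw [Nat.sub_add_cancel (by omega), hc, smul_eq_mul]
      field_simp
      ring

end CyclicSpan

/-! ### Invariant subspaces of linear flows -/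

section FlowInvariance

variable {X : Type*} [NormedAddCommGroup X] [NormedSpace ℝ X]

/-- `f x` is the derivative at `0` of the solution `exp (t f) x`, a limit of slopes that stay in the
closed subspace. -/
theorem IsFlowInvariant.map_mem_of_linear [CompleteSpace X] (f : X →L[ℝ] X) {V : Submodule ℝ X}
    (hV : IsClosed (V : Set X)) (h : IsFlowInvariant f (V : Set X)) {x : X} (hx : x ∈ V) :
    f x ∈ V := by
  have hd (t : ℝ) : HasDerivAt (fun t : ℝ => NormedSpace.exp (t • f) x)
      (f (NormedSpace.exp (t • f) x)) t :=
    (hasDerivAt_exp_smul_const' f t).clm_apply (hasDerivAt_const t x) |>.congr_deriv (by simp)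
  have hmem := h 0 1 (fun t : ℝ => NormedSpace.exp (t • f) x) le_rfl zero_le_one
    (fun t _ => (hd t).hasDerivWithinAt) (by simpa using hx)
  have h0 := (hasDerivWithinAt_iff_tendsto_slope' (s := Ioi (0 : ℝ)) (by simp)).1
    (hd 0).hasDerivWithinAt
  simp only [zero_smul, NormedSpace.exp_zero, one_apply_eq_self] at h0
  refine hV.mem_of_tendsto h0 ?_
  filter_upwards [Ioo_mem_nhdsGT (zero_lt_one' ℝ)] with t ht
  rw [slope_def_module]
  refine V.smul_mem _ (V.sub_mem (hmem t ⟨ht.1.le, ht.2.le⟩) (hmem 0 ⟨le_rfl, zero_le_one⟩))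

end FlowInvariance

/-! ### The adjacency map as an admissible vector field -/

namespace RegularNetwork

variable {C E : Type*} [Fintype C] (N : RegularNetwork C E)

theorem adjacencyMap_apply (x : C → ℂ) (c : C) (e : Fin N.valency ≃ {a : E // N.target a = c}) :
    N.adjacencyMap x c = ∑ i, x (N.source (e i).1) := by
  classical
  have hcard (j : C) : Nat.card {a : E // N.target a = c ∧ N.source a = j} =
      (Finset.univ.filter fun i => N.source (e i).1 = j).card := by
    rw [← Fintype.card_subtype, ← Nat.card_eq_fintype_card]
    refine Nat.card_congr ?_
    exact (Equiv.subtypeSubtypeEquivSubtypeInter _ (fun a => N.source a = j)).symm.trans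
      (e.subtypeEquiv fun _ => Iff.rfl).symm
  rw [adjacencyMap, Matrix.mulVecLin_apply, Matrix.mulVec, dotProduct,
    ← Finset.sum_fiberwise Finset.univ (fun i => N.source (e i).1)]
  refine Finset.sum_congr rfl fun j _ => ?_
  rw [Finset.sum_congr rfl (fun i hi => by rw [(Finset.mem_filter.1 hi).2]), Finset.sum_const,
    adjacencyMatrix, Matrix.of_apply, hcard, nsmul_eq_mul]

theorem isAdmissible_adjacencyMap : N.IsAdmissible N.adjacencyMap := by
  refine ⟨fun p => ∑ i, p.2 i, by fun_prop, fun u y σ => ?_, fun x c e => ?_⟩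
  · exact Equiv.sum_comp σ y
  · exact N.adjacencyMap_apply x c e

variable {N} in
theorem IsSynchrony.adjacencyMap_mem {S : Submodule ℂ (C → ℂ)} (hS : N.IsSynchrony S) {x : C → ℂ}
    (hx : x ∈ S) : N.adjacencyMap x ∈ S :=
  IsFlowInvariant.map_mem_of_linear
    (LinearMap.toContinuousLinearMap (N.adjacencyMap.restrictScalars ℝ))
    (V := S.restrictScalars ℝ) S.closed_of_finiteDimensional
    (hS.2 _ N.isAdmissible_adjacencyMap) hx

/-- A fully synchronous eigenvector of the adjacency map does not start a Jordan chain of length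
two: its eigenvalue is the valency, and the real parts of the coordinates obey a maximum
principle. -/
theorem sub_smul_ne_of_mem_fullySynchrony [Nonempty C] {μ : ℂ} {y z : C → ℂ}
    (hz : z ∈ fullySynchrony C) (hz0 : z ≠ 0) (hev : N.adjacencyMap z - μ • z = 0) :
    N.adjacencyMap y - μ • y ≠ z := by
  intro hy
  obtain ⟨c₀⟩ := ‹Nonempty C›
  have hzc (c : C) : z c = z c₀ := hz c c₀
  have ha : z c₀ ≠ 0 := fun h => hz0 (funext fun c => (hzc c).trans h)
  have hμ : μ = N.valency := by
    obtain ⟨e⟩ := N.inputs_equiv c₀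
    have h := congrFun hev c₀
    rw [Pi.sub_apply, N.adjacencyMap_apply z c₀ e] at h
    simp only [hzc, Finset.sum_const, Finset.card_univ, Fintype.card_fin, nsmul_eq_mul,
      Pi.smul_apply, smul_eq_mul, Pi.zero_apply, ← sub_mul] at h
    exact (sub_eq_zero.1 ((mul_eq_zero.1 h).resolve_right ha)).symm
  -- At a maximizing cell the inputs would have to sum to the valency times the maximum, plus one.
  obtain ⟨c, hc⟩ := Finite.exists_max fun c => (y c / z c₀).re
  obtain ⟨e⟩ := N.inputs_equiv c
  have h := congrFun hy c
  rw [Pi.sub_apply, N.adjacencyMap_apply y c e, hzc c, hμ, Pi.smul_apply, smul_eq_mul] at h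
  have h1 : ∑ i, y (N.source (e i).1) / z c₀ = N.valency * (y c / z c₀) + 1 := by
    rw [← Finset.sum_div]
    field_simp
    linear_combination h
  have h2 := congrArg Complex.re h1
  rw [Complex.re_sum, Complex.add_re, ← nsmul_eq_mul, Complex.re_nsmul, Complex.one_re] at h2
  have h3 := Finset.sum_le_card_nsmul Finset.univ
    (fun i => (y (N.source (e i).1) / z c₀).re) _ fun i _ => hc (N.source (e i).1)
  rw [h2, Finset.card_univ, Fintype.card_fin] at h3
  linarith

end RegularNetwork

/-! ### Polydiagonal hulls -/

section PolydiagonalHull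

variable {C : Type*}

theorem le_polydiagonalHull (W : Submodule ℂ (C → ℂ)) : W ≤ polydiagonalHull W :=
  (isLeast_polydiagonalHull W).1.2

theorem polydiagonalHull_le {W D : Submodule ℂ (C → ℂ)} (hD : IsPolydiagonal D) (h : W ≤ D) :
    polydiagonalHull W ≤ D :=
  (isLeast_polydiagonalHull W).2 ⟨hD, h⟩

theorem polydiagonalHull_mono {W W' : Submodule ℂ (C → ℂ)} (h : W ≤ polydiagonalHull W') :
    polydiagonalHull W ≤ polydiagonalHull W' :=
  polydiagonalHull_le (isLeast_polydiagonalHull W').1.1 h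

/-- The linear functional `x ↦ x a - x b`. -/
def coordSub (a b : C) : (C → ℂ) →ₗ[ℂ] ℂ :=
  LinearMap.proj (R := ℂ) (φ := fun _ : C => ℂ) a - LinearMap.proj (R := ℂ) (φ := fun _ : C => ℂ) b

theorem coordSub_eq_zero {a b : C} {x : C → ℂ} : coordSub a b x = 0 ↔ x a = x b :=
  sub_eq_zero (a := x a) (b := x b)

theorem apply_eq_of_mem_polydiagonalHull {W : Submodule ℂ (C → ℂ)} {a b : C}
    (h : ∀ x ∈ W, x a = x b) {x : C → ℂ} (hx : x ∈ polydiagonalHull W) : x a = x b := by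
  have hD : IsPolydiagonal (LinearMap.ker (coordSub a b)) :=
    ⟨fun i j => i = a ∧ j = b, fun x => by
      simp only [LinearMap.mem_ker, coordSub_eq_zero, and_imp, forall_eq_apply_imp_iff, forall_eq]⟩
  exact coordSub_eq_zero.1 (polydiagonalHull_le hD (fun x hx => coordSub_eq_zero.2 (h x hx)) hx)

theorem eq_fullySynchrony_of_finrank_eq_one {W : Submodule ℂ (C → ℂ)}
    (h : Module.finrank ℂ W = 1) {z : C → ℂ} (hz : z ∈ W) (hz0 : z ≠ 0)
    (hzF : z ∈ fullySynchrony C) : W = fullySynchrony C := by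
  obtain ⟨c, hc⟩ := Function.ne_iff.1 hz0
  refine le_antisymm (fun x hx => ?_) (fun x hx => ?_)
  · obtain ⟨t, ht⟩ := (finrank_eq_one_iff_of_nonzero' (⟨z, hz⟩ : W)
      (by simpa [Subtype.ext_iff] using hz0)).1 h ⟨x, hx⟩
    rw [← show t • z = x from congrArg Subtype.val ht]
    exact Submodule.smul_mem _ _ hzF
  · have : x = (x c / z c) • z := by
      funext i
      rw [Pi.smul_apply, smul_eq_mul, hzF i c, hx i c]
      exact (div_mul_cancel₀ _ hc).symm
    rw [this]
    exact W.smul_mem _ hz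

theorem fullySynchrony_le_of_isPolydiagonal {D : Submodule ℂ (C → ℂ)} (hD : IsPolydiagonal D) :
    fullySynchrony C ≤ D := by
  obtain ⟨r, hr⟩ := hD
  exact fun x hx => (hr x).2 fun i j _ => hx i j

end PolydiagonalHull

/-! ### Generalized eigenspaces -/

section GeneralizedEigenspaces

variable {X : Type*} [AddCommGroup X] [Module ℂ X]

theorem cyclicSpan_le_maxGenEigenspace {A : Module.End ℂ X} {μ : ℂ} {y : X} {k : ℕ}
    (h : ((A - μ • (1 : Module.End ℂ X)) ^ k) y = 0) :
    cyclicSpan (A - μ • (1 : Module.End ℂ X)) y ≤ A.maxGenEigenspace μ := by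
  refine Submodule.span_le.2 ?_
  rintro _ ⟨i, rfl⟩
  refine (A.mem_maxGenEigenspace μ _).2 ⟨k, ?_⟩
  dsimp only
  rw [← Module.End.mul_apply, ← pow_add]
  exact pow_apply_eq_zero_of_le h (by omega)

theorem eq_of_mem_maxGenEigenspace {A : Module.End ℂ X} {μ ν : ℂ} {y : X}
    (hμ : y ∈ A.maxGenEigenspace μ) (hν : y ∈ A.maxGenEigenspace ν) (hy : y ≠ 0) : μ = ν := by
  by_contra h
  exact hy ((Submodule.disjoint_def.1 (A.disjoint_genEigenspace h ⊤ ⊤)) y hμ hν)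

end GeneralizedEigenspaces

/-! ### Join-irreducible synchrony subspaces -/

namespace RegularNetwork

variable {C E : Type*} [Fintype C] {N : RegularNetwork C E}

theorem IsSynchrony.sub_smul_mem {S : Submodule ℂ (C → ℂ)} (hS : N.IsSynchrony S) (μ : ℂ) :
    ∀ x ∈ S, (N.adjacencyMap - μ • (1 : Module.End ℂ (C → ℂ))) x ∈ S := fun x hx => by
  simpa using S.sub_mem (hS.adjacencyMap_mem hx) (S.smul_mem μ hx)

theorem wellFoundedGT_synchronySubspace : WellFoundedGT N.SynchronySubspace :=
  StrictMono.wellFoundedGT (β := Submodule ℂ (C → ℂ)) (f := Subtype.val) fun _ _ h => h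

/-- The synchrony subspaces strictly below a join-irreducible one lie in a proper invariant
subspace. -/
theorem exists_invariant_of_isJoinIrreducible [Nonempty C] {S : N.SynchronySubspace}
    (hS : IsJoinIrreducible S) : ∃ V : Submodule ℂ (C → ℂ),
      (∀ μ : ℂ, ∀ x ∈ V, (N.adjacencyMap - μ • (1 : Module.End ℂ (C → ℂ))) x ∈ V) ∧
      ¬ S.1 ≤ V ∧ ∀ T : N.SynchronySubspace, T < S → T.1 ≤ V := by
  by_cases hne : {T : N.SynchronySubspace | T < S}.Nonempty
  · obtain ⟨T, hT, hmax⟩ := wellFoundedGT_synchronySubspace.wf.has_min _ hne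
    refine ⟨T.1, T.2.sub_smul_mem, fun h => absurd hT (not_lt_of_ge h), fun T' hT' => ?_⟩
    -- Join-irreducibility upgrades the maximal `T` to a greatest one.
    have hlt : T ⊔ T' < S := lt_of_le_of_ne (sup_le hT.le hT'.le) fun h =>
      hS ⟨T, T', hT.ne, hT'.ne, h⟩
    have hle : T ⊔ T' ≤ T := by
      by_contra h
      exact hmax _ hlt (lt_of_le_of_ne le_sup_left fun e => h e.ge)
    exact (le_sup_right : T' ≤ T ⊔ T').trans hle
  · refine ⟨⊥, fun μ x hx => ?_, fun h => ?_, fun T hT => absurd ⟨T, hT⟩ hne⟩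
    · rw [(Submodule.mem_bot ℂ).1 hx, map_zero]
      exact zero_mem _
    · have h1 := h (fullySynchrony_le_of_isPolydiagonal S.2.1
        (show (1 : C → ℂ) ∈ fullySynchrony C from fun _ _ => rfl))
      exact one_ne_zero ((Submodule.mem_bot ℂ).1 h1)

/-- An invariant `S` is the sum of its intersections with the generalized eigenspaces, so one of
these is not inside `V`. -/
theorem exists_pow_apply_eq_zero_of_not_le {S V : Submodule ℂ (C → ℂ)} (hS : N.IsSynchrony S)
    (h : ¬ S ≤ V) : ∃ (k : ℕ) (μ : ℂ), ∃ y ∈ S, y ∉ V ∧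
      ((N.adjacencyMap - μ • (1 : Module.End ℂ (C → ℂ))) ^ k) y = 0 := by
  by_contra! hcon
  refine h ?_
  have := Submodule.inf_iSup_genEigenspace (p := S) (f := N.adjacencyMap)
    (fun x hx => hS.adjacencyMap_mem hx) ⊤
  rw [show ⨆ μ, N.adjacencyMap.genEigenspace μ ⊤ = ⊤ from
    N.adjacencyMap.iSup_maxGenEigenspace_eq_top, inf_top_eq] at this
  rw [this]
  refine iSup_le fun μ y hy => ?_
  by_contra hyV
  obtain ⟨k, hk⟩ := (N.adjacencyMap.mem_maxGenEigenspace μ y).1 hy.2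
  exact hcon k μ y hy.1 hyV hk

/-- A Jordan subspace that meets the fully synchrony subspace in its eigenvector is the fully
synchrony subspace. -/
theorem cyclicSpan_eq_fullySynchrony [Nonempty C] {μ : ℂ} {u : C → ℂ} {k : ℕ}
    (h0 : ((N.adjacencyMap - μ • (1 : Module.End ℂ (C → ℂ))) ^ (k + 1)) u = 0)
    (h : ((N.adjacencyMap - μ • (1 : Module.End ℂ (C → ℂ))) ^ k) u ≠ 0)
    (hF : ((N.adjacencyMap - μ • (1 : Module.End ℂ (C → ℂ))) ^ k) u ∈ fullySynchrony C) :
    cyclicSpan (N.adjacencyMap - μ • (1 : Module.End ℂ (C → ℂ))) u = fullySynchrony C := by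
  cases k with
  | zero =>
    exact eq_fullySynchrony_of_finrank_eq_one (finrank_cyclicSpan h0 h)
      (pow_mem_cyclicSpan _ _ _) h hF
  | succ k =>
    rw [pow_succ', Module.End.mul_apply] at h0
    refine absurd ?_ (N.sub_smul_ne_of_mem_fullySynchrony hF h (by simpa using h0)
      (y := ((N.adjacencyMap - μ • (1 : Module.End ℂ (C → ℂ))) ^ k) u))
    rw [pow_succ', Module.End.mul_apply]
    simp

theorem exists_isSpecialJordan_isLeast [Nonempty C] {S : N.SynchronySubspace}
    (hS : IsJoinIrreducible S) : ∃ J : Submodule ℂ (C → ℂ), N.IsSpecialJordan J ∧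
      IsLeast {T : N.SynchronySubspace | J ≤ T.1} S := by
  classical
  obtain ⟨V, hVinv, hSV, hV⟩ := exists_invariant_of_isJoinIrreducible hS
  -- Minimality of `k + 1` over all eigenvalues makes each chain considered below have length
  -- exactly `k + 1`.
  obtain ⟨k, ⟨μ₀, y₀, hy₀S, hy₀V, hy₀⟩, hk⟩ :
      ∃ k, (∃ (μ : ℂ), ∃ y ∈ S.1, y ∉ V ∧
        ((N.adjacencyMap - μ • (1 : Module.End ℂ (C → ℂ))) ^ (k + 1)) y = 0) ∧
      ∀ (μ : ℂ), ∀ y ∈ S.1, y ∉ V →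
        ((N.adjacencyMap - μ • (1 : Module.End ℂ (C → ℂ))) ^ k) y ≠ 0 := by
    have hex := exists_pow_apply_eq_zero_of_not_le S.2 hSV
    have hspec := Nat.find_spec hex
    have hmin := fun m => Nat.find_min hex (m := m)
    generalize Nat.find hex = n at hspec hmin
    obtain _ | k := n
    · obtain ⟨μ, y, -, hyV, hy⟩ := hspec
      rw [pow_zero, Module.End.one_apply] at hy
      exact absurd (hy ▸ zero_mem V) hyV
    · exact ⟨k, hspec, fun μ y hyS hyV hy => hmin k (by omega) ⟨μ, y, hyS, hyV, hy⟩⟩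
  obtain ⟨μ, y, ⟨hyS, hyV, hy⟩, hmin⟩ : ∃ (μ : ℂ) (y : C → ℂ), (y ∈ S.1 ∧ y ∉ V ∧
        ((N.adjacencyMap - μ • (1 : Module.End ℂ (C → ℂ))) ^ (k + 1)) y = 0) ∧
      ∀ z ∈ S.1, z ∉ V → ((N.adjacencyMap - μ • (1 : Module.End ℂ (C → ℂ))) ^ (k + 1)) z = 0 →
        ¬ polydiagonalHull (cyclicSpan (N.adjacencyMap - μ • (1 : Module.End ℂ (C → ℂ))) z) <
          polydiagonalHull (cyclicSpan (N.adjacencyMap - μ • (1 : Module.End ℂ (C → ℂ))) y) := by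
    obtain ⟨y, hy, hmin⟩ := (InvImage.wf (fun y => polydiagonalHull
      (cyclicSpan (N.adjacencyMap - μ₀ • (1 : Module.End ℂ (C → ℂ))) y))
      (wellFounded_lt (α := Submodule ℂ (C → ℂ)))).has_min
        {y | y ∈ S.1 ∧ y ∉ V ∧
          ((N.adjacencyMap - μ₀ • (1 : Module.End ℂ (C → ℂ))) ^ (k + 1)) y = 0}
        ⟨y₀, hy₀S, hy₀V, hy₀⟩
    exact ⟨μ₀, y, hy, fun z h1 h2 h3 => hmin z ⟨h1, h2, h3⟩⟩
  have hSinv := S.2.sub_smul_mem μ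
  have hWS := cyclicSpan_le_of_invariant hSinv hyS
  have hPS := polydiagonalHull_le S.2.1 hWS
  have hyk := hk μ y hyS hyV
  refine ⟨_, ⟨isJordanSubspace_cyclicSpan hy hyk, μ, cyclicSpan_le_maxGenEigenspace hy, ?_⟩,
    hWS, fun T hT => ?_⟩
  · intro U hU hUμ hdim hPU
    by_contra! hcon
    obtain ⟨hPne, hUF⟩ := hcon
    obtain ⟨ν, l, u, hu0, hu, rfl⟩ := hU.exists_eq_cyclicSpan
    rw [finrank_cyclicSpan hy hyk, finrank_cyclicSpan hu0 hu, Nat.add_right_cancel_iff] at hdim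
    subst hdim
    obtain rfl : ν = μ := eq_of_mem_maxGenEigenspace (cyclicSpan_le_maxGenEigenspace hu0
      (self_mem_cyclicSpan _ u)) (hUμ (self_mem_cyclicSpan _ u)) fun h => hu (by rw [h, map_zero])
    set f := N.adjacencyMap - ν • (1 : Module.End ℂ (C → ℂ)) with hf
    have hUP := (le_polydiagonalHull (cyclicSpan f u)).trans hPU
    have huV : u ∈ V := by
      by_contra huV
      exact hmin u (hPS (hUP (self_mem_cyclicSpan f u))) huV hu0 (lt_of_le_of_ne hPU hPne)
    have hUV : cyclicSpan f u ≤ V := cyclicSpan_le_of_invariant (hVinv ν) huV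
    obtain ⟨a, b, hab⟩ : ∃ a b, ((f ^ l) u) a ≠ ((f ^ l) u) b := by
      by_contra! h
      exact hUF (cyclicSpan_eq_fullySynchrony hu0 hu h)
    obtain ⟨w, hw, hLw⟩ := exists_mem_cyclicSpan_forall_apply_eq_zero (coordSub a b) hy hu0
      (coordSub_eq_zero.not.2 hab)
    have hle : cyclicSpan f (y + w) ≤ polydiagonalHull (cyclicSpan f y) := by
      refine Submodule.span_le.2 ?_
      rintro _ ⟨i, rfl⟩
      dsimp only
      rw [map_add]
      exact add_mem (le_polydiagonalHull _ (pow_mem_cyclicSpan f y i))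
        (hUP (pow_mem_of_invariant (fun _ => map_mem_cyclicSpan) hw i))
    refine hmin (y + w) (hPS (hle (self_mem_cyclicSpan f _)))
      (fun h => hyV ((V.add_mem_iff_left (hUV hw)).1 h)) ?_
      -- Equal hulls would force `x a = x b` on the eigenvector of `U`.
      (lt_of_le_of_ne (polydiagonalHull_mono hle) fun h => hab ?_)
    · have hker : cyclicSpan f u ≤ LinearMap.ker (f ^ (l + 1)) := by
        refine cyclicSpan_le_of_invariant (fun x hx => ?_) hu0
        rw [LinearMap.mem_ker] at hx ⊢
        rw [← Module.End.mul_apply, ← pow_succ, pow_succ', Module.End.mul_apply, hx, map_zero]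
      rw [map_add, hy, LinearMap.mem_ker.1 (hker hw), add_zero]
    · refine apply_eq_of_mem_polydiagonalHull (W := cyclicSpan f (y + w)) (fun x hx => ?_)
        (h ▸ hUP (pow_mem_cyclicSpan f u l))
      suffices hs : cyclicSpan f (y + w) ≤ LinearMap.ker (coordSub a b) from
        coordSub_eq_zero.1 (hs hx)
      refine Submodule.span_le.2 ?_
      rintro _ ⟨i, rfl⟩
      exact hLw i
  · by_contra hST
    -- Otherwise `T ⊓ S` is strictly below `S`, hence inside `V`, yet contains `y`.
    have hlt : T ⊓ S < S := lt_of_le_of_ne inf_le_right fun h => hST (inf_eq_right.1 h)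
    have hmem : cyclicSpan (N.adjacencyMap - μ • (1 : Module.End ℂ (C → ℂ))) y ≤ (T ⊓ S).1 := by
      refine le_sInf ?_
      rintro _ ⟨R, rfl | rfl, rfl⟩
      exacts [hT, hWS]
    exact hyV (hV _ hlt (hmem (self_mem_cyclicSpan _ y)))

end RegularNetwork

theorem proposition5p1 {C E : Type*} [Fintype C] [Nonempty C] (N : RegularNetwork C E) :
    (∀ S : N.SynchronySubspace, IsJoinIrreducible S →
      ∃ J : Submodule ℂ (C → ℂ), N.IsSpecialJordan J ∧
        IsLeast {T : N.SynchronySubspace | J ≤ T.1} S) ∧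
    #{S : N.SynchronySubspace // IsJoinIrreducible S} ≤
      #{J : Submodule ℂ (C → ℂ) // N.IsSpecialJordan J} := by
  refine ⟨fun S hS => RegularNetwork.exists_isSpecialJordan_isLeast hS, ?_⟩
  choose J hJ hleast using fun S : {S : N.SynchronySubspace // IsJoinIrreducible S} =>
    RegularNetwork.exists_isSpecialJordan_isLeast S.2
  -- `S` is recovered from `J S` as a least element.
  refine Cardinal.mk_le_of_injective (f := fun S => ⟨J S, hJ S⟩) fun S S' h => Subtype.ext ?_
  have h' : J S = J S' := congrArg Subtype.val h
  exact (hleast S).unique (h' ▸ hleast S')
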